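/- Let $\Omega\subset\mathbb R^2$ be a bounded open set with weakly Lipschitz boundary: for every $y\in\partial\Omega$ there are a neighbourhood $V$ of $y$ and a bilipschitz map $\rho:\mathbb R^2\to\mathbb R^2$ such that $\Omega\cap V=\rho(\{x_2>0\})\cap V$, $(\mathbb R^2\setminus\overline\Omega)\cap V=\rho(\{x_2<0\})\cap V$ and $\partial\Omega\cap V=\rho(\{x_2=0\})\cap V$. Let $\mu,\varepsilon\in L_\infty(\Omega;\mathcal L(\mathbb C^3))$ be strictly accretive, i.e. for some $\alpha>0$ one has $\operatorname{Re}(\mu(x)v,v)\ge\alpha|v|^2$ and $\operatorname{Re}(\varepsilon(x)v,v)\ge\alpha|v|^2$ for almost all $x\in\Omega$ and all $v\in\mathbb C^3$, and let $\omega\in\mathbb C$, $\omega\ne0$. Write $\mathbb C^3=\mathbb C\times\mathbb C^2$, $v=(v_\perp,v_\parallel)$, and for a $3\times3$ matrix $M$ with blocks $M_{\perp\perp},M_{\perp\parallel},M_{\parallel\perp},M_{\parallel\parallel}$ put $$\overline M=\begin{bmatrix}M_{\perp\perp}&M_{\perp\parallel}\\0&I\end{bmatrix},\qquad \underline M=\begin{bmatrix}1&0\\M_{\parallel\perp}&M_{\parallel\parallel}\end{bmatrix},\qquad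 J=\begin{bmatrix}0&-1\\1&0\end{bmatrix}.$$ Let $\overline A=\operatorname{diag}(\overline\mu,\overline\varepsilon)$, $\underline A=\operatorname{diag}(\underline\mu,\underline\varepsilon)$ and $B=\underline A\,\overline A^{-1}$. All derivatives are in the sense of distributions, and $\operatorname{curl}(f_1,f_2)=\partial_1f_2-\partial_2f_1$ in the plane. Let $H_{\mathrm{div}}(\Omega;\mathbb C^2)$ and $H_{\mathrm{curl}}(\Omega;\mathbb C^2)$ be the spaces of $f\in L_2(\Omega;\mathbb C^2)$ with $\operatorname{div}f\in L_2(\Omega)$, respectively $\operatorname{curl}f\in L_2(\Omega)$, and let $H^0_{\mathrm{div}}(\Omega;\mathbb C^2)$ and $H^0_{\mathrm{curl}}(\Omega;\mathbb C^2)$ be the subspaces of those $f$ whose extension by zero $\tilde f$ to $\mathbb R^2$ satisfies $\operatorname{div}\tilde f\in L_2(\mathbb R^2)$, respectively $\operatorname{curl}\tilde f\in L_2(\mathbb R^2)$. Let $D$ be the operator in $L_2(\Omega;\mathbb C^6)$, $\mathbb C^6=\mathbb C\times\mathbb C^2\times\mathbb C\times\mathbb C^2$, $$D=\begin{bmatrix}0&\operatorname{div}&0&0\\-\nabla&0&0&i\omega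 J\\0&0&0&\operatorname{div}\\0&-i\omega J&-\nabla&0\end{bmatrix},\qquad \mathbf D(D)=H^1(\Omega)\times H^0_{\mathrm{div}}(\Omega;\mathbb C^2)\times H^1_0(\Omega)\times H_{\mathrm{div}}(\Omega;\mathbb C^2),$$ let $\mathbf R(D)$ be its range, and let $DB$ have the domain $\mathbf D(DB)=\{F\in L_2(\Omega;\mathbb C^6):BF\in\mathbf D(D)\}$. Let $f,g:\mathbb R\times\Omega\to\mathbb C^3$ be measurable functions such that $F(t)=(f(t,\cdot),g(t,\cdot))\in\mathbf R(D)\cap\mathbf D(DB)$ for every $t\in\mathbb R$, and such that $t\mapsto F(t)\in L_2(\Omega;\mathbb C^6)$ is differentiable with $$\partial_tF(t)+DBF(t)=0\qquad\text{for every }t\in\mathbb R.$$ Then $H=\overline\mu^{-1}f$ and $E=\overline\varepsilon^{-1}g$ belong to $L_2((a,b)\times\Omega;\mathbb C^3)$ for all real $a<b$ and solve, in the sense of distributions on $\mathbb R\times\Omega$ with coordinates $(t,x_1,x_2)$, the time-harmonic Maxwell system $$\operatorname{div}_{(t,x)}\mu H=0,\qquad i\omega\mu H+\operatorname{curl}_{(t,x)}E=0,\qquad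 i\omega\varepsilon E-\operatorname{curl}_{(t,x)}H=0,\qquad \operatorname{div}_{(t,x)}\varepsilon E=0.$$ Moreover, for every fixed $t\in\mathbb R$, $$\mu H\in L_2(\Omega)\times H^0_{\mathrm{div}}(\Omega;\mathbb C^2)\qquad\text{and}\qquad E\in L_2(\Omega)\times H^0_{\mathrm{curl}}(\Omega;\mathbb C^2).$$ -/

import Mathlib

open MeasureTheory Set Filter Topology
open scoped ENNReal NNReal Matrix

namespace Waveguide

noncomputable section

/-- The Euclidean plane, with its Lebesgue measure. -/
abbrev Plane : Type := EuclideanSpace ℝ (Fin 2)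

/-- `ℂ³ × ℂ³ = ℂ⁶`; the indices `inl 0, inr 0` are the components along the waveguide, and
`inl 1, inl 2, inr 1, inr 2` the transversal ones. (All norms on it are equivalent, hence give the
same space `L₂(Ω; ℂ⁶)` with the same topology.) -/
abbrev C6 : Type := Fin 3 ⊕ Fin 3 → ℂ

/-! ### Domains -/

/-- A bounded open set in the plane, separated from the exterior domain (the complement of its
closure) by a weakly Lipschitz interface: near each boundary point, a global bilipschitz map takes
the upper half plane, the lower half plane and the line onto `Ω`, the exterior domain and `∂Ω`. -/
structure IsWeaklyLipschitzDomain (Ω : Set Plane) : Prop where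
  isOpen : IsOpen Ω
  isBounded : Bornology.IsBounded Ω
  interface : ∀ y ∈ frontier Ω, ∃ V ∈ 𝓝 y, ∃ ρ : Plane → Plane,
    (∃ K : ℝ≥0, LipschitzWith K ρ) ∧ (∃ K : ℝ≥0, AntilipschitzWith K ρ) ∧
    Ω ∩ V = ρ '' {x | 0 < x 1} ∩ V ∧
    (closure Ω)ᶜ ∩ V = ρ '' {x | x 1 < 0} ∩ V ∧
    frontier Ω ∩ V = ρ '' {x | x 1 = 0} ∩ V

/-! ### Test functions and distributional derivatives -/

section Distributions

variable {X : Type*} [NormedAddCommGroup X] [NormedSpace ℝ X] [MeasureSpace X]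

/-- `φ ∈ C_c^∞(U; ℂ)`. -/
structure IsTestFunction (U : Set X) (φ : X → ℂ) : Prop where
  smooth : ContDiff ℝ (⊤ : ℕ∞) φ
  compact : HasCompactSupport φ
  support : tsupport φ ⊆ U

/-- The distribution on `U` given by the function `u`, applied to `φ`. -/
def distOf (U : Set X) (u : X → ℂ) (φ : X → ℂ) : ℂ :=
  ∫ x in U, φ x * u x

/-- The distributional derivative on `U` of `u` in the direction `v`, applied to `φ`. -/
def distDeriv (U : Set X) (v : X) (u : X → ℂ) (φ : X → ℂ) : ℂ :=
  -∫ x in U, fderiv ℝ φ x v * u x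

end Distributions

/-! ### Sobolev spaces in the plane -/

/-- The `i`-th coordinate vector of the plane. -/
def basisVec (i : Fin 2) : Plane := EuclideanSpace.single i 1

/-- `f ∈ L₂(U; ℂ²)`, `w ∈ L₂(U)` and `div f = w` in the sense of distributions on `U`:
that is, `f ∈ H_div(U; ℂ²)` with divergence `w`. -/
structure HasDiv (U : Set Plane) (f : Plane → Fin 2 → ℂ) (w : Plane → ℂ) : Prop where
  memLp : MemLp f 2 (volume.restrict U)
  memLp_div : MemLp w 2 (volume.restrict U)
  eq : ∀ φ : Plane → ℂ, IsTestFunction U φ →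
    distDeriv U (basisVec 0) (fun x => f x 0) φ + distDeriv U (basisVec 1) (fun x => f x 1) φ
      = distOf U w φ

/-- `f ∈ L₂(U; ℂ²)`, `w ∈ L₂(U)` and `curl f = ∂₁f₂ - ∂₂f₁ = w` in the sense of distributions on
`U`: that is, `f ∈ H_curl(U; ℂ²)` with curl `w`. -/
structure HasCurl (U : Set Plane) (f : Plane → Fin 2 → ℂ) (w : Plane → ℂ) : Prop where
  memLp : MemLp f 2 (volume.restrict U)
  memLp_curl : MemLp w 2 (volume.restrict U)
  eq : ∀ φ : Plane → ℂ, IsTestFunction U φ →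
    distDeriv U (basisVec 0) (fun x => f x 1) φ - distDeriv U (basisVec 1) (fun x => f x 0) φ
      = distOf U w φ

/-- `f ∈ H⁰_div(Ω; ℂ²)`, with `div₀ f = w`: `f` has divergence `w` on `Ω`, and its extension by zero
has a square integrable divergence on the whole plane. -/
def HasDivZero (Ω : Set Plane) (f : Plane → Fin 2 → ℂ) (w : Plane → ℂ) : Prop :=
  HasDiv Ω f w ∧ ∃ w' : Plane → ℂ, HasDiv univ (Ω.indicator f) w'

/-- `f ∈ H⁰_curl(Ω; ℂ²)`, with curl `w`. -/
def HasCurlZero (Ω : Set Plane) (f : Plane → Fin 2 → ℂ) (w : Plane → ℂ) : Prop :=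
  HasCurl Ω f w ∧ ∃ w' : Plane → ℂ, HasCurl univ (Ω.indicator f) w'

/-- The space `H⁰_div(Ω; ℂ²)`: fields tangential on the boundary in the weak sense. -/
def MemHDivZero (Ω : Set Plane) (f : Plane → Fin 2 → ℂ) : Prop := ∃ w, HasDivZero Ω f w

/-- The space `H⁰_curl(Ω; ℂ²)`: fields normal on the boundary in the weak sense. -/
def MemHCurlZero (Ω : Set Plane) (f : Plane → Fin 2 → ℂ) : Prop := ∃ w, HasCurlZero Ω f w

/-- `u ∈ H¹(Ω)` with weak gradient `p`. -/
structure HasGrad (Ω : Set Plane) (u : Plane → ℂ) (p : Plane → Fin 2 → ℂ) : Prop where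
  memLp : MemLp u 2 (volume.restrict Ω)
  memLp_grad : MemLp p 2 (volume.restrict Ω)
  eq : ∀ i : Fin 2, ∀ φ : Plane → ℂ, IsTestFunction Ω φ →
    distDeriv Ω (basisVec i) u φ = distOf Ω (fun x => p x i) φ

/-- `u ∈ H¹₀(Ω)`, the closure of `C_c^∞(Ω)` in `H¹(Ω)`, with weak gradient `p = ∇₀u`. -/
structure HasGradZero (Ω : Set Plane) (u : Plane → ℂ) (p : Plane → Fin 2 → ℂ) : Prop where
  hasGrad : HasGrad Ω u p
  approx : ∃ φ : ℕ → Plane → ℂ, (∀ n, IsTestFunction Ω (φ n)) ∧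
    Tendsto (fun n => eLpNorm (fun x => φ n x - u x) 2 (volume.restrict Ω)) atTop (𝓝 0) ∧
    ∀ i : Fin 2, Tendsto
      (fun n => eLpNorm (fun x => fderiv ℝ (φ n) x (basisVec i) - p x i) 2 (volume.restrict Ω))
      atTop (𝓝 0)

/-! ### Coefficients -/

/-- Essentially bounded measurable matrix functions on `Ω`, with values in `ℒ(ℂ³)`. -/
def IsBoundedCoefficient (Ω : Set Plane) (M : Plane → Matrix (Fin 3) (Fin 3) ℂ) : Prop :=
  ∀ i j, MemLp (fun x => M x i j) ∞ (volume.restrict Ω)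

/-- Pointwise strict accretivity: `Re (M(x) v, v) ≥ α ‖v‖²` with the Euclidean inner product. -/
def IsStrictlyAccretive (Ω : Set Plane) (M : Plane → Matrix (Fin 3) (Fin 3) ℂ) : Prop :=
  ∃ α : ℝ, 0 < α ∧ ∀ᵐ x ∂(volume.restrict Ω), ∀ v : Fin 3 → ℂ,
    α * ∑ i, ‖v i‖ ^ 2 ≤ (star v ⬝ᵥ (M x *ᵥ v)).re

/-- First row from `M`, the other two from the identity: the matrix with an overline. -/
def overMat (M : Matrix (Fin 3) (Fin 3) ℂ) : Matrix (Fin 3) (Fin 3) ℂ :=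
  Matrix.of ![M 0, ![0, 1, 0], ![0, 0, 1]]

/-- First row from the identity, the other two from `M`: the matrix with an underline. -/
def underMat (M : Matrix (Fin 3) (Fin 3) ℂ) : Matrix (Fin 3) (Fin 3) ℂ :=
  Matrix.of ![![1, 0, 0], M 1, M 2]

/-- `B = A̲ A̅⁻¹`, for `A̲ = diag(μ̲, ε̲)` and `A̅ = diag(μ̅, ε̅)`. -/
def matB (M N : Matrix (Fin 3) (Fin 3) ℂ) : Matrix (Fin 3 ⊕ Fin 3) (Fin 3 ⊕ Fin 3) ℂ :=
  Matrix.fromBlocks (underMat M) 0 0 (underMat N) *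
    (Matrix.fromBlocks (overMat M) 0 0 (overMat N))⁻¹

/-! ### The operator `D` -/

/-- The transversal part of a vector of `ℂ³`. -/
def par (v : Fin 3 → ℂ) : Fin 2 → ℂ := ![v 1, v 2]

/-- The rotation `J(a, b) = (-b, a)`. -/
def rotJ (v : Fin 2 → ℂ) : Fin 2 → ℂ := ![-(v 1), v 0]

/-- The first half of a vector of `ℂ⁶`. -/
def fstHalf (v : C6) : Fin 3 → ℂ := fun i => v (Sum.inl i)

/-- The second half of a vector of `ℂ⁶`. -/
def sndHalf (v : C6) : Fin 3 → ℂ := fun i => v (Sum.inr i)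

/-- The graph of the unbounded operator `D` in `L₂(Ω; ℂ⁶)`. With `U = (U₁, U₂, U₃, U₄)` according
to `ℂ⁶ = ℂ × ℂ² × ℂ × ℂ²`, it says that `U ∈ 𝐃(D)`, that is `U₁ ∈ H¹`, `U₂ ∈ H⁰_div`, `U₃ ∈ H¹₀`,
`U₄ ∈ H_div`, and that `V = DU`, that is
`V = (div₀ U₂, -∇U₁ + iωJU₄, div U₄, -iωJU₂ - ∇₀U₃)` almost everywhere on `Ω`. -/
def GraphD (Ω : Set Plane) (ω : ℂ) (U V : Plane → C6) : Prop :=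
  HasDivZero Ω (fun x => par (fstHalf (U x))) (fun x => fstHalf (V x) 0) ∧
  HasDiv Ω (fun x => par (sndHalf (U x))) (fun x => sndHalf (V x) 0) ∧
  (∃ p : Plane → Fin 2 → ℂ, HasGrad Ω (fun x => fstHalf (U x) 0) p ∧
    ∀ᵐ x ∂(volume.restrict Ω), par (fstHalf (V x)) =
      -p x + (Complex.I * ω) • rotJ (par (sndHalf (U x)))) ∧
  (∃ q : Plane → Fin 2 → ℂ, HasGradZero Ω (fun x => sndHalf (U x) 0) q ∧
    ∀ᵐ x ∂(volume.restrict Ω), par (sndHalf (V x)) =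
      -((Complex.I * ω) • rotJ (par (fstHalf (U x)))) - q x)

/-- `F ∈ 𝐑(D)`. -/
def MemRangeD (Ω : Set Plane) (ω : ℂ) (F : Plane → C6) : Prop := ∃ U, GraphD Ω ω U F

/-- The graph of `DB`: `F ∈ 𝐃(DB)`, that is `F ∈ L₂` and `BF ∈ 𝐃(D)`, and `V = D(BF)`. -/
def GraphDB (Ω : Set Plane) (ω : ℂ) (μ ε : Plane → Matrix (Fin 3) (Fin 3) ℂ)
    (F V : Plane → C6) : Prop :=
  MemLp F 2 (volume.restrict Ω) ∧ GraphD Ω ω (fun x => matB (μ x) (ε x) *ᵥ F x) V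

/-- `F(t) ∈ 𝐃(DB)`, `F` is differentiable at `t` as a function with values in `L₂(Ω; ℂ⁶)`, and
`∂ₜF + DBF = 0`, for every real `t`. -/
def SolvesODE (Ω : Set Plane) (ω : ℂ) (μ ε : Plane → Matrix (Fin 3) (Fin 3) ℂ)
    (F : ℝ → Plane → C6) (hF : ∀ t, MemLp (F t) 2 (volume.restrict Ω)) : Prop :=
  ∀ t : ℝ, ∃ (V : Plane → C6) (hV : MemLp V 2 (volume.restrict Ω)), GraphDB Ω ω μ ε (F t) V ∧
    HasDerivAt (fun s => (hF s).toLp (F s)) (-(hV.toLp V)) t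

/-! ### Maxwell's equations in the waveguide -/

/-- The coordinate vectors of `ℝ × ℝ²`, with coordinates `(t, x₁, x₂)`. -/
def dir : Fin 3 → ℝ × Plane := ![(1, 0), (0, basisVec 0), (0, basisVec 1)]

/-- The distribution `div_{(t,x)} G`, applied to `φ`. -/
def distDiv3 (W : Set (ℝ × Plane)) (G : ℝ × Plane → Fin 3 → ℂ) (φ : ℝ × Plane → ℂ) : ℂ :=
  ∑ i, distDeriv W (dir i) (fun p => G p i) φ

/-- The three components of the distribution `curl_{(t,x)} G`, applied to `φ`. -/
def distCurl3 (W : Set (ℝ × Plane)) (G : ℝ × Plane → Fin 3 → ℂ) (φ : ℝ × Plane → ℂ) :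
    Fin 3 → ℂ :=
  ![distDeriv W (dir 1) (fun p => G p 2) φ - distDeriv W (dir 2) (fun p => G p 1) φ,
    distDeriv W (dir 2) (fun p => G p 0) φ - distDeriv W (dir 0) (fun p => G p 2) φ,
    distDeriv W (dir 0) (fun p => G p 1) φ - distDeriv W (dir 1) (fun p => G p 0) φ]

/-- `H` and `E` are square integrable on `(a, b) × Ω` for all real `a, b`, and solve the
time-harmonic Maxwell system in the sense of distributions on `ℝ × Ω`. -/
structure SolvesMaxwell (Ω : Set Plane) (ω : ℂ) (μ ε : Plane → Matrix (Fin 3) (Fin 3) ℂ)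
    (H E : ℝ → Plane → Fin 3 → ℂ) : Prop where
  memLp_H : ∀ a b : ℝ,
    MemLp (fun p : ℝ × Plane => H p.1 p.2) 2 (volume.restrict (Ioo a b ×ˢ Ω))
  memLp_E : ∀ a b : ℝ,
    MemLp (fun p : ℝ × Plane => E p.1 p.2) 2 (volume.restrict (Ioo a b ×ˢ Ω))
  div_H : ∀ φ : ℝ × Plane → ℂ, IsTestFunction (univ ×ˢ Ω) φ →
    distDiv3 (univ ×ˢ Ω) (fun p => μ p.2 *ᵥ H p.1 p.2) φ = 0
  curl_E : ∀ φ : ℝ × Plane → ℂ, IsTestFunction (univ ×ˢ Ω) φ → ∀ i : Fin 3,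
    Complex.I * ω * distOf (univ ×ˢ Ω) (fun p => (μ p.2 *ᵥ H p.1 p.2) i) φ
      + distCurl3 (univ ×ˢ Ω) (fun p => E p.1 p.2) φ i = 0
  curl_H : ∀ φ : ℝ × Plane → ℂ, IsTestFunction (univ ×ˢ Ω) φ → ∀ i : Fin 3,
    Complex.I * ω * distOf (univ ×ˢ Ω) (fun p => (ε p.2 *ᵥ E p.1 p.2) i) φ
      - distCurl3 (univ ×ˢ Ω) (fun p => H p.1 p.2) φ i = 0
  div_E : ∀ φ : ℝ × Plane → ℂ, IsTestFunction (univ ×ˢ Ω) φ →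
    distDiv3 (univ ×ˢ Ω) (fun p => ε p.2 *ᵥ E p.1 p.2) φ = 0

end

end Waveguide

open Waveguide

namespace Waveguide

/-! ### Test functions -/

section TestFunctions

variable {X : Type*} [NormedAddCommGroup X] [NormedSpace ℝ X]

/-! The substitution is pure algebra: `F = A̅ (H, E) = ((μH)_⊥, H_∥, (εE)_⊥, E_∥)` and `BF = A̲ (H,
E) = (H_⊥, (μH)_∥, E_⊥, (εE)_∥)`. Accretivity bounds `μ_⊥⊥` and `ε_⊥⊥` away from zero, so `A̅⁻¹` is
bounded and `H`, `E` are as integrable as `F`.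

The evolution equation contains six of the eight scalar Maxwell equations: its scalar rows are the
two divergence equations, its vector rows the transversal components of the two curl equations. The
two longitudinal components hold no `t`-derivative and come from `F(t) ∈ 𝐑(D)`. If `F = DU`, then
`F₂ = iωJU₄ - ∇U₁` and `F₄ = -iωJU₂ - ∇U₃`. As `curl J = div` and `curl ∇ = 0`
(`HasDiv.hasCurl_rotJ_add`, `HasGrad.hasCurl`), this gives `curl H_∥ = iω(εE)_⊥` and `curl E_∥ =
-iω(μH)_⊥`.

The boundary condition on `μH` is part of `BF ∈ 𝐃(D)`. That on `E` comes from `U₂ ∈ H⁰_div` and `U₃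
∈ H¹₀`, since the formula for `F₄` survives extension by zero (`HasGradZero.hasCurl_indicator`).

The passage from fixed `t` to distributions on the cylinder is Fubini, together with the product
rule for the moments `∫ φ(t,x) Fⱼ(t,x) dx`: they are differentiable and integrable in `t`, so their
derivative integrates to zero (`integral_moment_deriv_eq_zero`, then `div_cylinder` and
`grad_cylinder`). -/

theorem IsTestFunction.continuous {U : Set X} {φ : X → ℂ} (h : IsTestFunction U φ) :
    Continuous φ := h.smooth.continuous

theorem IsTestFunction.differentiable {U : Set X} {φ : X → ℂ} (h : IsTestFunction U φ) :
    Differentiable ℝ φ := h.smooth.differentiable (by simp)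

theorem IsTestFunction.fderiv_apply {U : Set X} {φ : X → ℂ} (h : IsTestFunction U φ) (v : X) :
    IsTestFunction U (fun x => fderiv ℝ φ x v) where
  smooth := (h.smooth.fderiv_right (m := ((⊤ : ℕ∞) : WithTop ℕ∞)) (by simp)).clm_apply
    contDiff_const
  compact := h.compact.fderiv_apply ℝ v
  support := (tsupport_fderiv_apply_subset ℝ v).trans h.support

theorem IsTestFunction.memLp [MeasurableSpace X] [OpensMeasurableSpace X] {U : Set X} {φ : X → ℂ}
    (h : IsTestFunction U φ) (p : ℝ≥0∞) (m : Measure X) [IsFiniteMeasureOnCompacts m] :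
    MemLp φ p m := h.continuous.memLp_of_hasCompactSupport h.compact

theorem IsTestFunction.iterated_fderiv_comm {U : Set X} {φ : X → ℂ} (h : IsTestFunction U φ)
    (v w x : X) :
    fderiv ℝ (fun y => fderiv ℝ φ y v) x w = fderiv ℝ (fun y => fderiv ℝ φ y w) x v := by
  have hd : DifferentiableAt ℝ (fderiv ℝ φ) x :=
    (h.smooth.fderiv_right (m := 1) (by norm_cast)).differentiable (by simp) x
  have hs : IsSymmSndFDerivAt ℝ φ x := h.smooth.contDiffAt.isSymmSndFDerivAt
    (by rw [minSmoothness_of_isRCLikeNormedField]; exact WithTop.coe_le_coe.2 le_top)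
  rw [fderiv_clm_apply hd (differentiableAt_const v), fderiv_clm_apply hd (differentiableAt_const w)]
  simpa using hs w v

/-- A time slice of a test function on a cylinder. -/
theorem IsTestFunction.slice {Ω : Set X} {φ : ℝ × X → ℂ} (h : IsTestFunction (univ ×ˢ Ω) φ)
    (t : ℝ) : IsTestFunction Ω (fun x => φ (t, x)) := by
  have hK : IsCompact (Prod.snd '' tsupport φ) := IsCompact.image h.compact continuous_snd
  have hsub : tsupport (fun x => φ (t, x)) ⊆ (fun x => (t, x)) ⁻¹' tsupport φ :=
    tsupport_comp_subset_preimage φ (by fun_prop)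
  refine ⟨h.smooth.comp (contDiff_const.prodMk contDiff_id), ?_, fun x hx => (h.support (hsub hx)).2⟩
  exact hK.of_isClosed_subset (isClosed_tsupport _) fun x hx => ⟨(t, x), hsub hx, rfl⟩

theorem IsTestFunction.fderiv_slice {U : Set (ℝ × X)} {φ : ℝ × X → ℂ} (h : IsTestFunction U φ)
    (t : ℝ) (x v : X) : fderiv ℝ (fun y => φ (t, y)) x v = fderiv ℝ φ (t, x) (0, v) := by
  have h1 : HasFDerivAt (fun y : X => (t, y)) (ContinuousLinearMap.inr ℝ ℝ X) x :=
    hasFDerivAt_prodMk_right t x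
  have h2 := (h.differentiable (t, x)).hasFDerivAt.comp x h1
  rw [show (fun y => φ (t, y)) = φ ∘ fun y => (t, y) from rfl, h2.fderiv]
  simp

theorem IsTestFunction.hasDerivAt_time {U : Set (ℝ × X)} {φ : ℝ × X → ℂ} (h : IsTestFunction U φ)
    (t : ℝ) (x : X) : HasDerivAt (fun s => φ (s, x)) (fderiv ℝ φ (t, x) (1, 0)) t := by
  have h1 : HasFDerivAt (fun s : ℝ => (s, x)) (ContinuousLinearMap.inl ℝ ℝ X) t :=
    hasFDerivAt_prodMk_left t x
  simpa [Function.comp_def] using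
    ((h.differentiable (t, x)).hasFDerivAt.comp t h1).hasDerivAt

/-- Second order Taylor estimate in time, uniformly in space. -/
theorem IsTestFunction.exists_time_taylor_bound {U : Set (ℝ × X)} {φ : ℝ × X → ℂ}
    (h : IsTestFunction U φ) : ∃ C : ℝ, 0 ≤ C ∧ ∀ (s t : ℝ) (x : X),
      ‖φ (s, x) - φ (t, x) - (s - t) * fderiv ℝ φ (t, x) (1, 0)‖ ≤ C * |s - t| ^ 2 := by
  obtain ⟨C, hC⟩ := (h.fderiv_apply (1, 0)).smooth.lipschitzWith_of_hasCompactSupport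
    (h.fderiv_apply (1, 0)).compact (by simp)
  refine ⟨C, C.2, fun s t x => ?_⟩
  -- Mean value inequality for `φ(·, x)` minus its linear part at `t`; the Lipschitz constant of
  -- `∂ₜφ` bounds the derivative uniformly in `x`.
  have key := (convex_uIcc t s).norm_image_sub_le_of_norm_hasDerivWithin_le (𝕜 := ℝ)
    (f := fun r => φ (r, x) - r * fderiv ℝ φ (t, x) (1, 0))
    (f' := fun r => fderiv ℝ φ (r, x) (1, 0) - fderiv ℝ φ (t, x) (1, 0))
    (C := C * |s - t|) (x := t) (y := s) ?_ ?_ left_mem_uIcc right_mem_uIcc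
  · calc _ = ‖φ (s, x) - s * fderiv ℝ φ (t, x) (1, 0)
            - (φ (t, x) - t * fderiv ℝ φ (t, x) (1, 0))‖ := by congr 1; ring
      _ ≤ _ := key
      _ = _ := by rw [Real.norm_eq_abs]; ring
  · intro r _
    have h1 := h.hasDerivAt_time r x
    have h2 : HasDerivAt (fun r : ℝ => (r : ℂ) * fderiv ℝ φ (t, x) (1, 0))
        (fderiv ℝ φ (t, x) (1, 0)) r := by
      simpa using (Complex.ofRealCLM.hasDerivAt (x := r)).mul_const (fderiv ℝ φ (t, x) (1, 0))
    exact (h1.sub h2).hasDerivWithinAt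
  · intro r hr
    have := hC.dist_le_mul (r, x) (t, x)
    rw [dist_eq_norm] at this
    refine this.trans ?_
    gcongr
    rw [Prod.dist_eq, dist_self, max_eq_left dist_nonneg, Real.dist_eq]
    simpa using abs_sub_left_of_mem_uIcc hr

end TestFunctions

/-! ### Fields on the cylinder -/

theorem restrict_univ_prod (Ω : Set Plane) :
    (volume.restrict (univ ×ˢ Ω) : Measure (ℝ × Plane)) = volume.prod (volume.restrict Ω) := by
  rw [Measure.volume_eq_prod, ← Measure.prod_restrict, Measure.restrict_univ]

theorem restrict_Ioo_prod (a b : ℝ) (Ω : Set Plane) :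
    (volume.restrict (Ioo a b ×ˢ Ω) : Measure (ℝ × Plane)) =
      (volume.restrict (Ioo a b)).prod (volume.restrict Ω) := by
  rw [Measure.volume_eq_prod, ← Measure.prod_restrict]

/-- All time slices are square integrable, and the field is square integrable on bounded time
intervals. -/
structure IsLocallyL2 (Ω : Set Plane) (u : ℝ → Plane → ℂ) : Prop where
  slice : ∀ t, MemLp (u t) 2 (volume.restrict Ω)
  loc : ∀ a b : ℝ, MemLp (fun p : ℝ × Plane => u p.1 p.2) 2 (volume.restrict (Ioo a b ×ˢ Ω))

/-- The order of quantifiers matters: one planar null set `N` serves all `t`, so the exceptional set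
in the cylinder lies in the null set `ℝ × N`. -/
theorem IsLocallyL2.congr {Ω : Set Plane} {u v : ℝ → Plane → ℂ} (hu : IsLocallyL2 Ω u)
    (h : ∀ᵐ x ∂volume.restrict Ω, ∀ t, u t x = v t x) : IsLocallyL2 Ω v where
  slice t := (hu.slice t).ae_eq (h.mono fun x hx => hx t)
  loc a b := by
    refine (hu.loc a b).ae_eq ?_
    rw [restrict_Ioo_prod]
    exact (Measure.quasiMeasurePreserving_snd.ae h).mono fun p hp => hp p.1

theorem IsLocallyL2.sub {Ω : Set Plane} {u v : ℝ → Plane → ℂ} (hu : IsLocallyL2 Ω u)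
    (hv : IsLocallyL2 Ω v) : IsLocallyL2 Ω (fun t x => u t x - v t x) where
  slice t := (hu.slice t).sub (hv.slice t)
  loc a b := (hu.loc a b).sub (hv.loc a b)

theorem IsLocallyL2.add {Ω : Set Plane} {u v : ℝ → Plane → ℂ} (hu : IsLocallyL2 Ω u)
    (hv : IsLocallyL2 Ω v) : IsLocallyL2 Ω (fun t x => u t x + v t x) where
  slice t := (hu.slice t).add (hv.slice t)
  loc a b := (hu.loc a b).add (hv.loc a b)

theorem IsLocallyL2.coeff_mul {Ω : Set Plane} {u : ℝ → Plane → ℂ} {m : Plane → ℂ}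
    (hu : IsLocallyL2 Ω u) (hm : MemLp m ∞ (volume.restrict Ω)) :
    IsLocallyL2 Ω (fun t x => m x * u t x) where
  slice t := (hu.slice t).mul' hm
  loc a b := by
    refine (hu.loc a b).mul' (q := 2) (p := ∞) ?_
    rw [restrict_Ioo_prod]
    refine memLp_top_of_bound hm.1.comp_snd (eLpNormEssSup m (volume.restrict Ω)).toReal ?_
    have hfin : eLpNormEssSup m (volume.restrict Ω) ≠ ∞ := by simpa using hm.2.ne
    have := Measure.quasiMeasurePreserving_snd (μ := volume.restrict (Ioo a b))
      |>.ae (enorm_ae_le_eLpNormEssSup m (volume.restrict Ω))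
    filter_upwards [this] with p hp
    have := (ENNReal.toReal_le_toReal (by simp) hfin).2 hp
    simpa using this

/-- Square integrability of a field with uniformly bounded slices. -/
theorem memLp_Ioo_prod_of_bounded {Ω : Set Plane} {u : ℝ → Plane → ℂ} {a b C : ℝ}
    (hm : AEStronglyMeasurable (fun p : ℝ × Plane => u p.1 p.2) (volume.restrict (univ ×ˢ Ω)))
    (hC : ∀ t ∈ Ioo a b, eLpNorm (u t) 2 (volume.restrict Ω) ≤ ENNReal.ofReal C) :
    MemLp (fun p : ℝ × Plane => u p.1 p.2) 2 (volume.restrict (Ioo a b ×ˢ Ω)) := by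
  have hm' : AEStronglyMeasurable (fun p : ℝ × Plane => u p.1 p.2)
      (volume.restrict (Ioo a b ×ˢ Ω)) :=
    hm.mono_measure (Measure.restrict_mono (prod_mono (subset_univ _) le_rfl) le_rfl)
  refine ⟨hm', ?_⟩
  rw [eLpNorm_lt_top_iff_lintegral_rpow_enorm_lt_top (by simp) (by simp)]
  rw [restrict_Ioo_prod] at hm' ⊢
  rw [lintegral_prod _ (hm'.enorm.pow_const _)]
  have hb : ∀ t ∈ Ioo a b, (∫⁻ x, ‖u t x‖ₑ ^ (2 : ℝ≥0∞).toReal ∂volume.restrict Ω)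
      ≤ ENNReal.ofReal C ^ (2 : ℝ) := by
    intro t ht
    have h1 := hC t ht
    rw [eLpNorm_eq_lintegral_rpow_enorm_toReal (by simp) (by simp)] at h1
    have h2 := ENNReal.rpow_le_rpow h1 (z := 2) (by norm_num)
    rwa [← ENNReal.rpow_mul, show (1 / (2 : ℝ≥0∞).toReal * 2 : ℝ) = 1 by simp,
      ENNReal.rpow_one] at h2
  calc _ ≤ ∫⁻ t in Ioo a b, ENNReal.ofReal C ^ (2 : ℝ) :=
        setLIntegral_mono measurable_const hb
    _ < ∞ := by
      rw [setLIntegral_const, Real.volume_Ioo]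
      exact ENNReal.mul_lt_top (by finiteness) (by finiteness)

/-- The components of a continuous curve in `L₂(Ω; ℂ⁶)`. -/
theorem isLocallyL2_of_continuous {Ω : Set Plane} {F : ℝ → Plane → C6}
    (hF : ∀ t, MemLp (F t) 2 (volume.restrict Ω))
    (hcont : Continuous fun t => (hF t).toLp (F t)) (j : Fin 3 ⊕ Fin 3)
    (hm : AEStronglyMeasurable (fun p : ℝ × Plane => F p.1 p.2 j)
      (volume.restrict (univ ×ˢ Ω))) :
    IsLocallyL2 Ω (fun t x => F t x j) where
  slice t := (hF t).eval j
  loc a b := by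
    obtain ⟨C, hC⟩ := (isCompact_Icc (a := a) (b := b)).exists_bound_of_continuousOn
      hcont.continuousOn
    refine memLp_Ioo_prod_of_bounded (u := fun t x => F t x j) hm (C := C) fun t ht => ?_
    calc eLpNorm (fun x => F t x j) 2 (volume.restrict Ω)
        ≤ eLpNorm (F t) 2 (volume.restrict Ω) :=
          eLpNorm_mono fun x => norm_le_pi_norm (F t x) j
      _ = ENNReal.ofReal ‖(hF t).toLp (F t)‖ := by
          rw [Lp.norm_toLp, ENNReal.ofReal_toReal (hF t).2.ne]
      _ ≤ _ := ENNReal.ofReal_le_ofReal (hC t (Ioo_subset_Icc_self ht))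

theorem IsLocallyL2.integrable_mul {Ω : Set Plane} (hΩ : MeasurableSet Ω) {u : ℝ → Plane → ℂ}
    (hu : IsLocallyL2 Ω u) {ψ : ℝ × Plane → ℂ} (hψ : IsTestFunction (univ ×ˢ Ω) ψ) :
    Integrable (fun p => ψ p * u p.1 p.2) (volume.restrict (univ ×ˢ Ω)) := by
  -- Only a bounded time interval matters, and there the product is integrable by Hölder.
  have hK : IsCompact (Prod.fst '' tsupport ψ) := IsCompact.image hψ.compact continuous_fst
  obtain ⟨R, hR⟩ := hK.isBounded.subset_ball 0
  have h1 : IntegrableOn (fun p => ψ p * u p.1 p.2) (Ioo (-R) R ×ˢ Ω) :=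
    (hψ.memLp 2 _).integrable_mul (hu.loc (-R) R)
  refine h1.of_forall_sdiff_eq_zero (MeasurableSet.univ.prod hΩ) fun p hp => ?_
  have : p ∉ tsupport ψ := fun hmem => hp.2 ⟨by
    have := hR ⟨p, hmem, rfl⟩
    rw [Real.ball_eq_Ioo] at this
    simpa using this, hp.1.2⟩
  simp [image_eq_zero_of_notMem_tsupport this]

theorem IsLocallyL2.integral_mul {Ω : Set Plane} (hΩ : MeasurableSet Ω) {u : ℝ → Plane → ℂ}
    (hu : IsLocallyL2 Ω u) {ψ : ℝ × Plane → ℂ} (hψ : IsTestFunction (univ ×ˢ Ω) ψ) :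
    ∫ p in univ ×ˢ Ω, ψ p * u p.1 p.2 = ∫ t, ∫ x in Ω, ψ (t, x) * u t x := by
  have := hu.integrable_mul hΩ hψ
  rw [restrict_univ_prod] at this ⊢
  exact integral_prod _ this

theorem IsLocallyL2.integrable_integral_mul {Ω : Set Plane} (hΩ : MeasurableSet Ω)
    {u : ℝ → Plane → ℂ} (hu : IsLocallyL2 Ω u) {ψ : ℝ × Plane → ℂ}
    (hψ : IsTestFunction (univ ×ˢ Ω) ψ) :
    Integrable (fun t => ∫ x in Ω, ψ (t, x) * u t x) := by
  have := hu.integrable_mul hΩ hψ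
  rw [restrict_univ_prod] at this
  exact this.integral_prod_left

/-! ### Differentiation of moments -/

/-- The Taylor estimate is uniform in `x`; on a set of finite measure it becomes an `L₂` remainder
`O((s - t)²)`, with the factor `|Ω|^{1/2}`. -/
theorem hasDerivAt_toLp_testFunction {Ω : Set Plane} [IsFiniteMeasure (volume.restrict Ω)]
    {φ : ℝ × Plane → ℂ} (h : IsTestFunction (univ ×ˢ Ω) φ) (t : ℝ) :
    HasDerivAt (fun s => ((h.slice s).memLp 2 (volume.restrict Ω)).toLp (fun x => φ (s, x)))
      ((((h.fderiv_apply (1, 0)).slice t).memLp 2 (volume.restrict Ω)).toLp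
        (fun x => fderiv ℝ φ (t, x) (1, 0))) t := by
  obtain ⟨C, hC0, hC⟩ := h.exists_time_taylor_bound
  rw [hasDerivAt_iff_isLittleO]
  set M : ℝ := measureUnivNNReal (volume.restrict Ω) ^ (2 : ℝ≥0∞).toReal⁻¹ with hM
  have hO : (fun s => ((h.slice s).memLp 2 (volume.restrict Ω)).toLp (fun x => φ (s, x))
      - ((h.slice t).memLp 2 (volume.restrict Ω)).toLp (fun x => φ (t, x))
      - (s - t) • (((h.fderiv_apply (1, 0)).slice t).memLp 2 (volume.restrict Ω)).toLp
        (fun x => fderiv ℝ φ (t, x) (1, 0))) =O[𝓝 t] fun s => (s - t) ^ 2 := by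
    refine Asymptotics.IsBigO.of_bound (M * C) (Eventually.of_forall fun s => ?_)
    have := Lp.norm_le_of_ae_bound (p := 2) (μ := volume.restrict Ω) (C := C * |s - t| ^ 2)
      (f := ((h.slice s).memLp 2 (volume.restrict Ω)).toLp (fun x => φ (s, x))
      - ((h.slice t).memLp 2 (volume.restrict Ω)).toLp (fun x => φ (t, x))
      - (s - t) • (((h.fderiv_apply (1, 0)).slice t).memLp 2 (volume.restrict Ω)).toLp
        (fun x => fderiv ℝ φ (t, x) (1, 0))) (by positivity) ?_
    · refine this.trans_eq ?_
      rw [norm_pow, Real.norm_eq_abs, ← hM]; ring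
    · rw [← MemLp.toLp_const_smul, ← MemLp.toLp_sub, ← MemLp.toLp_sub]
      filter_upwards [MemLp.coeFn_toLp ((((h.slice s).memLp 2 (volume.restrict Ω)).sub
        ((h.slice t).memLp 2 (volume.restrict Ω))).sub
        ((((h.fderiv_apply (1, 0)).slice t).memLp 2 (volume.restrict Ω)).const_smul (s - t)))]
        with x hx
      rw [hx]
      simpa using hC s t x
  refine hO.trans_isLittleO ?_
  have : Tendsto (fun s : ℝ => s - t) (𝓝 t) (𝓝 0) := by
    simpa using (continuous_sub_right t).tendsto t
  simpa [Function.comp_def] using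
    (Asymptotics.isLittleO_pow_id (𝕜 := ℝ) (n := 2) (by norm_num)).comp_tendsto this

theorem hasDerivAt_moment {Ω : Set Plane} [IsFiniteMeasure (volume.restrict Ω)]
    {F : ℝ → Plane → C6} {V : Plane → C6} (hF : ∀ t, MemLp (F t) 2 (volume.restrict Ω))
    (hV : MemLp V 2 (volume.restrict Ω)) {t : ℝ}
    (hd : HasDerivAt (fun s => (hF s).toLp (F s)) (-(hV.toLp V)) t)
    {φ : ℝ × Plane → ℂ} (h : IsTestFunction (univ ×ˢ Ω) φ) (j : Fin 3 ⊕ Fin 3) :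
    HasDerivAt (fun s => ∫ x in Ω, φ (s, x) * F s x j)
      ((∫ x in Ω, fderiv ℝ φ (t, x) (1, 0) * F t x j) - ∫ x in Ω, φ (t, x) * V x j) t := by
  -- The bilinear map `(z, v) ↦ z vⱼ` makes the moment an `L₂` pairing, to which the product rule
  -- applies.
  let B : ℂ →L[ℝ] C6 →L[ℝ] ℂ :=
    (ContinuousLinearMap.compL ℝ C6 ℂ ℂ).flip (ContinuousLinearMap.proj j) ∘L
      ContinuousLinearMap.mul ℝ ℂ
  have hB : ∀ z v, B z v = z * v j := fun z v => rfl
  have key := (B.lpPairing (volume.restrict Ω) 2 2).hasDerivAt_of_bilinear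
    (fun _ => hasDerivAt_toLp_testFunction h t) (fun _ => hd)
  have hpair : ∀ {a : Plane → ℂ} {b : Plane → C6} (ha : MemLp a 2 (volume.restrict Ω))
      (hb : MemLp b 2 (volume.restrict Ω)),
      B.lpPairing (volume.restrict Ω) 2 2 (ha.toLp a) (hb.toLp b) = ∫ x in Ω, a x * b x j := by
    intro a b ha hb
    rw [ContinuousLinearMap.lpPairing_eq_integral]
    refine integral_congr_ae ?_
    filter_upwards [ha.coeFn_toLp, hb.coeFn_toLp] with x h1 h2
    rw [h1, h2, hB]
  simp only [map_neg, hpair] at key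
  exact key.congr_deriv (neg_add_eq_sub _ _)

/-- Integration by parts in time. The fundamental theorem is used for an everywhere differentiable
function with integrable derivative, so no continuity of `V` in `t` is needed. Integrability `hi` is
assumed because `V` is given separately for each `t`, with no joint measurability. -/
theorem integral_moment_deriv_eq_zero {Ω : Set Plane} (hΩ : MeasurableSet Ω)
    [IsFiniteMeasure (volume.restrict Ω)]
    {F V : ℝ → Plane → C6} (hF : ∀ t, MemLp (F t) 2 (volume.restrict Ω))
    (hV : ∀ t, MemLp (V t) 2 (volume.restrict Ω))
    (hd : ∀ t, HasDerivAt (fun s => (hF s).toLp (F s)) (-((hV t).toLp (V t))) t)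
    {φ : ℝ × Plane → ℂ} (h : IsTestFunction (univ ×ˢ Ω) φ) (j : Fin 3 ⊕ Fin 3)
    (hj : IsLocallyL2 Ω fun t x => F t x j)
    (hi : Integrable fun t => ∫ x in Ω, φ (t, x) * V t x j) :
    distDeriv (univ ×ˢ Ω) (dir 0) (fun p => F p.1 p.2 j) φ
      = -∫ t, ∫ x in Ω, φ (t, x) * V t x j := by
  have h0 : dir 0 = (1, 0) := rfl
  have h1 := hj.integrable_integral_mul hΩ (h.fderiv_apply (1, 0))
  have h2 := integral_eq_zero_of_hasDerivAt_of_integrable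
    (fun t => hasDerivAt_moment hF (hV t) (hd t) h j) (h1.sub hi)
    (hj.integrable_integral_mul hΩ h)
  rw [integral_sub h1 hi, sub_eq_zero] at h2
  rw [distDeriv, h0, hj.integral_mul hΩ (h.fderiv_apply (1, 0)), h2]

/-! ### From slices to the cylinder -/

theorem distDeriv_cylinder {Ω : Set Plane} (hΩ : MeasurableSet Ω) {u : ℝ → Plane → ℂ}
    (hu : IsLocallyL2 Ω u) {φ : ℝ × Plane → ℂ} (h : IsTestFunction (univ ×ˢ Ω) φ) (v : Plane) :
    distDeriv (univ ×ˢ Ω) (0, v) (fun p => u p.1 p.2) φ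
      = ∫ t, distDeriv Ω v (u t) (fun x => φ (t, x)) := by
  simp only [distDeriv, h.fderiv_slice]
  rw [hu.integral_mul hΩ (h.fderiv_apply (0, v)), integral_neg]

theorem integrable_distDeriv_slice {Ω : Set Plane} (hΩ : MeasurableSet Ω) {u : ℝ → Plane → ℂ}
    (hu : IsLocallyL2 Ω u) {φ : ℝ × Plane → ℂ} (h : IsTestFunction (univ ×ˢ Ω) φ) (v : Plane) :
    Integrable fun t => distDeriv Ω v (u t) (fun x => φ (t, x)) := by
  simp only [distDeriv, h.fderiv_slice]
  exact (hu.integrable_integral_mul hΩ (h.fderiv_apply (0, v))).neg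

theorem distOf_cylinder {Ω : Set Plane} (hΩ : MeasurableSet Ω) {u : ℝ → Plane → ℂ}
    (hu : IsLocallyL2 Ω u) {φ : ℝ × Plane → ℂ} (h : IsTestFunction (univ ×ˢ Ω) φ) :
    distOf (univ ×ˢ Ω) (fun p => u p.1 p.2) φ = ∫ t, distOf Ω (u t) (fun x => φ (t, x)) :=
  hu.integral_mul hΩ h

theorem integrable_distOf_slice {Ω : Set Plane} (hΩ : MeasurableSet Ω) {u : ℝ → Plane → ℂ}
    (hu : IsLocallyL2 Ω u) {φ : ℝ × Plane → ℂ} (h : IsTestFunction (univ ×ˢ Ω) φ) :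
    Integrable fun t => distOf Ω (u t) (fun x => φ (t, x)) :=
  hu.integrable_integral_mul hΩ h

/-- If `curl b(t) = w(t)` in the plane for every `t`, the longitudinal component of the
three-dimensional curl is `w`. -/
theorem curl_cylinder {Ω : Set Plane} (hΩ : MeasurableSet Ω) {b : ℝ → Plane → Fin 2 → ℂ}
    {w : ℝ → Plane → ℂ} (hb : ∀ k, IsLocallyL2 Ω fun t x => b t x k) (hw : IsLocallyL2 Ω w)
    (hc : ∀ t, HasCurl Ω (b t) (w t)) {φ : ℝ × Plane → ℂ} (h : IsTestFunction (univ ×ˢ Ω) φ) :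
    distDeriv (univ ×ˢ Ω) (dir 1) (fun p => b p.1 p.2 1) φ
      - distDeriv (univ ×ˢ Ω) (dir 2) (fun p => b p.1 p.2 0) φ
      = distOf (univ ×ˢ Ω) (fun p => w p.1 p.2) φ := by
  have h1 : dir 1 = (0, basisVec 0) := rfl
  have h2 : dir 2 = (0, basisVec 1) := rfl
  rw [h1, h2, distDeriv_cylinder hΩ (hb 1) h, distDeriv_cylinder hΩ (hb 0) h,
    distOf_cylinder hΩ hw h, ← integral_sub (integrable_distDeriv_slice hΩ (hb 1) h _)
      (integrable_distDeriv_slice hΩ (hb 0) h _)]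
  exact integral_congr_ae (Eventually.of_forall fun t => (hc t).eq _ (h.slice t))

/-- If `∂ₜ Fⱼ + div a = 0` for every `t`, then `(Fⱼ, a)` is divergence free on the cylinder. -/
theorem div_cylinder {Ω : Set Plane} (hΩ : MeasurableSet Ω) [IsFiniteMeasure (volume.restrict Ω)]
    {F V : ℝ → Plane → C6} (hF : ∀ t, MemLp (F t) 2 (volume.restrict Ω))
    (hV : ∀ t, MemLp (V t) 2 (volume.restrict Ω))
    (hd : ∀ t, HasDerivAt (fun s => (hF s).toLp (F s)) (-((hV t).toLp (V t))) t)
    {j : Fin 3 ⊕ Fin 3} (hj : IsLocallyL2 Ω fun t x => F t x j)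
    {a : ℝ → Plane → Fin 2 → ℂ} (ha : ∀ k, IsLocallyL2 Ω fun t x => a t x k)
    (hdiv : ∀ t, HasDiv Ω (a t) fun x => V t x j)
    {φ : ℝ × Plane → ℂ} (h : IsTestFunction (univ ×ˢ Ω) φ) :
    distDeriv (univ ×ˢ Ω) (dir 0) (fun p => F p.1 p.2 j) φ
      + distDeriv (univ ×ˢ Ω) (dir 1) (fun p => a p.1 p.2 0) φ
      + distDeriv (univ ×ˢ Ω) (dir 2) (fun p => a p.1 p.2 1) φ = 0 := by
  have h1 : dir 1 = (0, basisVec 0) := rfl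
  have h2 : dir 2 = (0, basisVec 1) := rfl
  have i0 := integrable_distDeriv_slice hΩ (ha 0) h (basisVec 0)
  have i1 := integrable_distDeriv_slice hΩ (ha 1) h (basisVec 1)
  -- The planar weak equation replaces `V` by the jointly measurable field `a`; this supplies both
  -- the integrability in `t` and the value.
  have he : (fun t => ∫ x in Ω, φ (t, x) * V t x j) = fun t =>
      distDeriv Ω (basisVec 0) (fun x => a t x 0) (fun x => φ (t, x))
        + distDeriv Ω (basisVec 1) (fun x => a t x 1) (fun x => φ (t, x)) :=
    funext fun t => ((hdiv t).eq _ (h.slice t)).symm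
  rw [integral_moment_deriv_eq_zero hΩ hF hV hd h j hj (he ▸ i0.add i1), he, integral_add i0 i1,
    h1, h2, distDeriv_cylinder hΩ (ha 0) h, distDeriv_cylinder hΩ (ha 1) h]
  ring

/-- If `∂ₜ Fⱼ - ∂ₖ u + c b = 0` for every `t`, then this holds on the cylinder. -/
theorem grad_cylinder {Ω : Set Plane} (hΩ : MeasurableSet Ω) [IsFiniteMeasure (volume.restrict Ω)]
    {F V : ℝ → Plane → C6} (hF : ∀ t, MemLp (F t) 2 (volume.restrict Ω))
    (hV : ∀ t, MemLp (V t) 2 (volume.restrict Ω))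
    (hd : ∀ t, HasDerivAt (fun s => (hF s).toLp (F s)) (-((hV t).toLp (V t))) t)
    {j : Fin 3 ⊕ Fin 3} (hj : IsLocallyL2 Ω fun t x => F t x j)
    {u b : ℝ → Plane → ℂ} (hu : IsLocallyL2 Ω u) (hb : IsLocallyL2 Ω b) (c : ℂ) (k : Fin 2)
    {p : ℝ → Plane → Fin 2 → ℂ} (hgrad : ∀ t, HasGrad Ω (u t) (p t))
    (hVeq : ∀ t, ∀ᵐ x ∂volume.restrict Ω, V t x j = -p t x k + c * b t x)
    {φ : ℝ × Plane → ℂ} (h : IsTestFunction (univ ×ˢ Ω) φ) :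
    distDeriv (univ ×ˢ Ω) (dir 0) (fun p => F p.1 p.2 j) φ
      - distDeriv (univ ×ˢ Ω) (0, basisVec k) (fun p => u p.1 p.2) φ
      + c * distOf (univ ×ˢ Ω) (fun p => b p.1 p.2) φ = 0 := by
  have i0 : Integrable fun t => -distDeriv Ω (basisVec k) (u t) fun x => φ (t, x) :=
    (integrable_distDeriv_slice hΩ hu h (basisVec k)).neg
  have i1 := integrable_distOf_slice hΩ hb h
  -- Likewise, `V` and the gradient `p`, neither known to be measurable in `t`, are eliminated in
  -- favour of `u` and `b`.
  have he : (fun t => ∫ x in Ω, φ (t, x) * V t x j) = fun t =>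
      -distDeriv Ω (basisVec k) (u t) (fun x => φ (t, x))
        + c * distOf Ω (b t) (fun x => φ (t, x)) := by
    funext t
    have m := (h.slice t).memLp 2 (volume.restrict Ω)
    have e1 : Integrable (fun x => -(φ (t, x) * p t x k)) (volume.restrict Ω) :=
      (m.integrable_mul ((hgrad t).memLp_grad.eval k)).neg
    have e2 : Integrable (fun x => φ (t, x) * b t x) (volume.restrict Ω) :=
      m.integrable_mul (hb.slice t)
    rw [(hgrad t).eq k _ (h.slice t), distOf, distOf, ← integral_const_mul, ← integral_neg,
      ← integral_add e1 (e2.const_mul c)]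
    refine integral_congr_ae ((hVeq t).mono fun x hx => ?_)
    simp only [hx]
    ring
  rw [integral_moment_deriv_eq_zero hΩ hF hV hd h j hj (he ▸ i0.add (i1.const_mul c)), he,
    integral_add i0 (i1.const_mul c), integral_neg, integral_const_mul,
    distDeriv_cylinder hΩ hu h, distOf_cylinder hΩ hb h]
  ring

/-! ### Planar vector calculus -/

theorem distDeriv_congr {Ω : Set Plane} {u v : Plane → ℂ} (h : u =ᵐ[volume.restrict Ω] v)
    (e : Plane) (φ : Plane → ℂ) : distDeriv Ω e u φ = distDeriv Ω e v φ := by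
  unfold distDeriv
  congr 1
  refine integral_congr_ae ?_
  filter_upwards [h] with x hx
  rw [hx]

theorem HasDiv.congr {Ω : Set Plane} {f g : Plane → Fin 2 → ℂ} {w : Plane → ℂ}
    (hf : HasDiv Ω f w) (h : f =ᵐ[volume.restrict Ω] g) : HasDiv Ω g w where
  memLp := hf.memLp.ae_eq h
  memLp_div := hf.memLp_div
  eq φ hφ := by
    rw [← hf.eq φ hφ, distDeriv_congr (h.mono fun x hx => congrFun hx 0),
      distDeriv_congr (h.mono fun x hx => congrFun hx 1)]

theorem HasDivZero.congr {Ω : Set Plane} (hΩ : MeasurableSet Ω) {f g : Plane → Fin 2 → ℂ}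
    {w : Plane → ℂ} (hf : HasDivZero Ω f w) (h : f =ᵐ[volume.restrict Ω] g) :
    HasDivZero Ω g w := by
  obtain ⟨h1, w', h2⟩ := hf
  refine ⟨h1.congr h, w', h2.congr ?_⟩
  rw [Measure.restrict_univ]
  exact (ae_eq_restrict_iff_indicator_ae_eq hΩ).1 h

theorem HasGrad.congr {Ω : Set Plane} {u v : Plane → ℂ} {p : Plane → Fin 2 → ℂ}
    (hu : HasGrad Ω u p) (h : u =ᵐ[volume.restrict Ω] v) : HasGrad Ω v p where
  memLp := hu.memLp.ae_eq h
  memLp_grad := hu.memLp_grad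
  eq i φ hφ := by rw [← hu.eq i φ hφ, distDeriv_congr h]

/-- Gradients are curl free. -/
theorem HasGrad.hasCurl {Ω : Set Plane} {u : Plane → ℂ} {p : Plane → Fin 2 → ℂ}
    (h : HasGrad Ω u p) : HasCurl Ω p 0 where
  memLp := h.memLp_grad
  memLp_curl := MemLp.zero
  eq φ hφ := by
    -- Testing `∂₂u` with `∂₁φ` and `∂₁u` with `∂₂φ` gives the same integral, by symmetry of the
    -- second derivative of `φ`.
    have h1 := h.eq 1 _ (hφ.fderiv_apply (basisVec 0))
    have h0 := h.eq 0 _ (hφ.fderiv_apply (basisVec 1))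
    simp only [distDeriv, distOf, hφ.iterated_fderiv_comm (basisVec 1) (basisVec 0)] at h0 h1 ⊢
    rw [← h0, ← h1]
    simp

theorem setIntegral_mul_indicator {Ω : Set Plane} (hΩ : MeasurableSet Ω) (ψ : Plane → ℂ)
    (q : Plane → Fin 2 → ℂ) (i : Fin 2) :
    ∫ x in univ, ψ x * Ω.indicator q x i = ∫ x in Ω, ψ x * q x i := by
  rw [setIntegral_univ, ← integral_indicator hΩ]
  congr 1
  funext x
  by_cases hx : x ∈ Ω <;> simp [hx]

/-- One integration by parts puts both derivatives on `η`, where they commute. -/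
theorem integral_fderiv_mul_fderiv_comm {U W : Set Plane} {φ η : Plane → ℂ}
    (hφ : IsTestFunction U φ) (hη : IsTestFunction W η) (v w : Plane) :
    ∫ x, fderiv ℝ φ x v * fderiv ℝ η x w = ∫ x, fderiv ℝ φ x w * fderiv ℝ η x v := by
  have key : ∀ v w : Plane, ∫ x, fderiv ℝ φ x v * fderiv ℝ η x w
      = -∫ x, φ x * fderiv ℝ (fun y => fderiv ℝ η y w) x v := by
    intro v w
    have hw := hη.fderiv_apply w
    have int : ∀ {A B : Set Plane} {α β : Plane → ℂ}, IsTestFunction A α → IsTestFunction B β →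
        Integrable (fun x => α x * β x) := fun ha hb =>
      (ha.memLp 2 volume).integrable_mul (hb.memLp 2 volume)
    rw [integral_mul_fderiv_eq_neg_fderiv_mul_of_integrable (int (hφ.fderiv_apply v) hw)
      (int hφ (hw.fderiv_apply v)) (int hφ hw) (fun x _ => hφ.differentiable x)
      (fun x _ => hw.differentiable x), neg_neg]
  rw [key v w, key w v]
  simp only [hη.iterated_fderiv_comm w v]

theorem tendsto_setIntegral_mul_of_tendsto_eLpNorm {Ω : Set Plane} {ψ q : Plane → ℂ}
    {r : ℕ → Plane → ℂ} (hψ : MemLp ψ 2 (volume.restrict Ω)) (hq : MemLp q 2 (volume.restrict Ω))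
    (hr : ∀ n, MemLp (r n) 2 (volume.restrict Ω))
    (h : Tendsto (fun n => eLpNorm (fun x => r n x - q x) 2 (volume.restrict Ω)) atTop (𝓝 0)) :
    Tendsto (fun n => ∫ x in Ω, ψ x * r n x) atTop (𝓝 (∫ x in Ω, ψ x * q x)) := by
  have hlim : Tendsto (fun n => (hr n).toLp (r n)) atTop (𝓝 (hq.toLp q)) :=
    (Lp.tendsto_Lp_iff_tendsto_eLpNorm'' r hr q hq).2 h
  have hpair : ∀ {b : Plane → ℂ} (hb : MemLp b 2 (volume.restrict Ω)),
      (ContinuousLinearMap.mul ℝ ℂ).lpPairing (volume.restrict Ω) 2 2 (hψ.toLp ψ) (hb.toLp b)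
        = ∫ x in Ω, ψ x * b x := by
    intro b hb
    rw [ContinuousLinearMap.lpPairing_eq_integral]
    refine integral_congr_ae ?_
    filter_upwards [hψ.coeFn_toLp, hb.coeFn_toLp] with x h1 h2
    rw [h1, h2, ContinuousLinearMap.mul_apply']
  have := (((ContinuousLinearMap.mul ℝ ℂ).lpPairing (volume.restrict Ω) 2 2
    (hψ.toLp ψ)).continuous.tendsto _).comp hlim
  simpa only [Function.comp_def, hpair] using this

/-- The zero extension of the gradient of a function in `H¹₀` is curl free in the whole plane. -/
theorem HasGradZero.hasCurl_indicator {Ω : Set Plane} (hΩ : MeasurableSet Ω) {u : Plane → ℂ}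
    {q : Plane → Fin 2 → ℂ} (h : HasGradZero Ω u q) : HasCurl univ (Ω.indicator q) 0 where
  memLp := by
    rw [Measure.restrict_univ]
    exact (memLp_indicator_iff_restrict hΩ).2 h.hasGrad.memLp_grad
  memLp_curl := MemLp.zero
  eq φ hφ := by
    -- The zero extension of each `∇ηₙ` is a smooth gradient on the whole plane; the curl identity
    -- for it passes to the `L₂` limit.
    obtain ⟨η, hη, -, hlim⟩ := h.approx
    have lim : ∀ i v, Tendsto (fun n => ∫ x in Ω, fderiv ℝ φ x v * fderiv ℝ (η n) x (basisVec i))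
        atTop (𝓝 (∫ x in Ω, fderiv ℝ φ x v * q x i)) := fun i v =>
      tendsto_setIntegral_mul_of_tendsto_eLpNorm ((hφ.fderiv_apply v).memLp 2 _)
        (h.hasGrad.memLp_grad.eval i)
        (fun n => ((hη n).fderiv_apply (basisVec i)).memLp 2 _) (hlim i)
    have full : ∀ n v w, ∫ x in Ω, fderiv ℝ φ x v * fderiv ℝ (η n) x w
        = ∫ x, fderiv ℝ φ x v * fderiv ℝ (η n) x w := by
      intro n v w
      refine setIntegral_eq_integral_of_forall_compl_eq_zero fun x hx => ?_
      have : x ∉ tsupport fun y => fderiv ℝ (η n) y w :=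
        fun hmem => hx (((hη n).fderiv_apply w).support hmem)
      rw [image_eq_zero_of_notMem_tsupport (f := fun y => fderiv ℝ (η n) y w) this, mul_zero]
    have heq : ∫ x in Ω, fderiv ℝ φ x (basisVec 0) * q x 1
        = ∫ x in Ω, fderiv ℝ φ x (basisVec 1) * q x 0 := by
      refine tendsto_nhds_unique (lim 1 (basisVec 0)) ((lim 0 (basisVec 1)).congr fun n => ?_)
      rw [full, full, integral_fderiv_mul_fderiv_comm hφ (hη n)]
    simp only [distDeriv, distOf, setIntegral_mul_indicator hΩ, heq]
    simp

/-- The curl of `c J a + d q` with `q` curl free. -/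
theorem HasDiv.hasCurl_rotJ_add {U : Set Plane} {a q b : Plane → Fin 2 → ℂ} {w : Plane → ℂ}
    (ha : HasDiv U a w) (hq : HasCurl U q 0) (c d : ℂ)
    (hb : ∀ᵐ x ∂volume.restrict U, b x = c • rotJ (a x) + d • q x) :
    HasCurl U b (fun x => c * w x) where
  memLp := by
    have hrot : MemLp (fun x => rotJ (a x)) 2 (volume.restrict U) := by
      refine MemLp.of_eval fun i => ?_
      fin_cases i
      · exact (ha.memLp.eval 1).neg
      · exact ha.memLp.eval 0
    exact ((hrot.const_smul c).add (hq.memLp.const_smul d)).ae_eq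
      (hb.mono fun x hx => by rw [hx]; rfl)
  memLp_curl := ha.memLp_div.const_mul c
  eq φ hφ := by
    have hd := ha.eq φ hφ
    have hc := hq.eq φ hφ
    have int : ∀ {g : Plane → Fin 2 → ℂ}, MemLp g 2 (volume.restrict U) → ∀ v i,
        Integrable (fun x => fderiv ℝ φ x v * g x i) (volume.restrict U) := fun hg v i =>
      ((hφ.fderiv_apply v).memLp 2 _).integrable_mul (hg.eval i)
    have e1 : ∫ x in U, fderiv ℝ φ x (basisVec 0) * b x 1
        = c * (∫ x in U, fderiv ℝ φ x (basisVec 0) * a x 0)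
          + d * ∫ x in U, fderiv ℝ φ x (basisVec 0) * q x 1 := by
      rw [← integral_const_mul, ← integral_const_mul,
        ← integral_add ((int ha.memLp _ 0).const_mul c) ((int hq.memLp _ 1).const_mul d)]
      refine integral_congr_ae (hb.mono fun x hx => ?_)
      simp only [hx, rotJ, Pi.add_apply, Pi.smul_apply, smul_eq_mul, Matrix.cons_val_one,
        Matrix.cons_val_fin_one]
      ring
    have e2 : ∫ x in U, fderiv ℝ φ x (basisVec 1) * b x 0
        = -c * (∫ x in U, fderiv ℝ φ x (basisVec 1) * a x 1)
          + d * ∫ x in U, fderiv ℝ φ x (basisVec 1) * q x 0 := by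
      rw [← integral_const_mul, ← integral_const_mul,
        ← integral_add ((int ha.memLp _ 1).const_mul (-c)) ((int hq.memLp _ 0).const_mul d)]
      refine integral_congr_ae (hb.mono fun x hx => ?_)
      simp only [hx, rotJ, Pi.add_apply, Pi.smul_apply, smul_eq_mul, Matrix.cons_val_zero]
      ring
    have e3 : distOf U (fun x => c * w x) φ = c * distOf U w φ := by
      simp only [distOf, ← integral_const_mul]
      congr 1
      funext x
      ring
    rw [e3, ← hd]
    simp only [distDeriv, distOf, Pi.zero_apply, mul_zero, integral_zero] at hc ⊢
    rw [e1, e2]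
    linear_combination d * hc

/-! ### Coefficients -/

theorem IsStrictlyAccretive.exists_bound {Ω : Set Plane} {M : Plane → Matrix (Fin 3) (Fin 3) ℂ}
    (h : IsStrictlyAccretive Ω M) :
    ∃ α : ℝ, 0 < α ∧ ∀ᵐ x ∂volume.restrict Ω, α ≤ ‖M x 0 0‖ := by
  obtain ⟨α, hα, hM⟩ := h
  refine ⟨α, hα, hM.mono fun x hx => ?_⟩
  -- Accretivity on the longitudinal unit vector only sees `M_⊥⊥`.
  have := hx ![1, 0, 0]
  simp only [Fin.sum_univ_three, dotProduct, Matrix.mulVec] at this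
  refine le_trans ?_ (Complex.re_le_norm _)
  simpa using this

theorem IsStrictlyAccretive.ae_ne_zero {Ω : Set Plane} {M : Plane → Matrix (Fin 3) (Fin 3) ℂ}
    (h : IsStrictlyAccretive Ω M) : ∀ᵐ x ∂volume.restrict Ω, M x 0 0 ≠ 0 := by
  obtain ⟨α, hα, hM⟩ := h.exists_bound
  exact hM.mono fun x hx => norm_pos_iff.1 (hα.trans_le hx)

theorem IsStrictlyAccretive.memLp_inv {Ω : Set Plane} {M : Plane → Matrix (Fin 3) (Fin 3) ℂ}
    (h : IsStrictlyAccretive Ω M) (hb : IsBoundedCoefficient Ω M) :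
    MemLp (fun x => (M x 0 0)⁻¹) ∞ (volume.restrict Ω) := by
  obtain ⟨α, hα, hM⟩ := h.exists_bound
  refine memLp_top_of_bound (hb 0 0).1.aemeasurable.inv.aestronglyMeasurable α⁻¹
    (hM.mono fun x hx => ?_)
  rw [norm_inv]
  exact inv_anti₀ hα hx

theorem isUnit_overMat {M : Matrix (Fin 3) (Fin 3) ℂ} (h : M 0 0 ≠ 0) : IsUnit (overMat M) := by
  rw [Matrix.isUnit_iff_isUnit_det]
  simpa [overMat, Matrix.det_fin_three] using h

theorem overMat_mulVec (M : Matrix (Fin 3) (Fin 3) ℂ) (v : Fin 3 → ℂ) :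
    overMat M *ᵥ v = ![(M *ᵥ v) 0, v 1, v 2] := by
  ext i
  fin_cases i <;> simp [overMat, Matrix.mulVec, dotProduct, Fin.sum_univ_three]

theorem underMat_mulVec (M : Matrix (Fin 3) (Fin 3) ℂ) (v : Fin 3 → ℂ) :
    underMat M *ᵥ v = ![v 0, (M *ᵥ v) 1, (M *ᵥ v) 2] := by
  ext i
  fin_cases i <;> simp [underMat, Matrix.mulVec, dotProduct, Fin.sum_univ_three]

theorem overMat_inv_mulVec {M : Matrix (Fin 3) (Fin 3) ℂ} (h : M 0 0 ≠ 0) (v : Fin 3 → ℂ) :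
    v = ![(M *ᵥ ((overMat M)⁻¹ *ᵥ v)) 0, ((overMat M)⁻¹ *ᵥ v) 1, ((overMat M)⁻¹ *ᵥ v) 2] := by
  rw [← overMat_mulVec, Matrix.mulVec_mulVec, Matrix.mul_nonsing_inv _
    ((Matrix.isUnit_iff_isUnit_det _).1 (isUnit_overMat h)), Matrix.one_mulVec]

theorem overMat_inv_mulVec_zero {M : Matrix (Fin 3) (Fin 3) ℂ} (h : M 0 0 ≠ 0) (v : Fin 3 → ℂ) :
    ((overMat M)⁻¹ *ᵥ v) 0
      = (M 0 0)⁻¹ * (v 0 - M 0 1 * v 1 - M 0 2 * v 2) := by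
  have e := overMat_inv_mulVec h v
  have e0 := congrFun e 0
  have e1 := congrFun e 1
  have e2 := congrFun e 2
  set w := (overMat M)⁻¹ *ᵥ v
  simp only [Matrix.cons_val_zero, Matrix.cons_val_one, Matrix.cons_val, Matrix.mulVec, dotProduct,
    Fin.sum_univ_three] at e0 e1 e2
  rw [e0, e1, e2]
  field_simp
  ring

theorem matB_mulVec {M N : Matrix (Fin 3) (Fin 3) ℂ} (hM : M 0 0 ≠ 0) (hN : N 0 0 ≠ 0)
    (v w : Fin 3 → ℂ) : matB M N *ᵥ Sum.elim v w =
      Sum.elim (underMat M *ᵥ ((overMat M)⁻¹ *ᵥ v)) (underMat N *ᵥ ((overMat N)⁻¹ *ᵥ w)) := by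
  rw [matB, Matrix.inv_fromBlocks_zero₂₁_of_isUnit_iff _ _ _
    (iff_of_true (isUnit_overMat hM) (isUnit_overMat hN)), ← Matrix.mulVec_mulVec]
  simp [Matrix.fromBlocks_mulVec, Function.comp_def]

/-- `A̅⁻¹` preserves locally square integrable fields. -/
theorem isLocallyL2_overMat_inv {Ω : Set Plane} {M : Plane → Matrix (Fin 3) (Fin 3) ℂ}
    (hb : IsBoundedCoefficient Ω M) (ha : IsStrictlyAccretive Ω M) {f : ℝ → Plane → Fin 3 → ℂ}
    (hf : ∀ i, IsLocallyL2 Ω fun t x => f t x i) (i : Fin 3) :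
    IsLocallyL2 Ω fun t x => ((overMat (M x))⁻¹ *ᵥ f t x) i := by
  match i with
  | 0 =>
    -- `A̅⁻¹` changes only the longitudinal component, by the explicit formula `M_⊥⊥⁻¹ (f_⊥ - M_⊥∥
    -- f_∥)`.
    refine ((((hf 0).sub ((hf 1).coeff_mul (hb 0 1))).sub ((hf 2).coeff_mul (hb 0 2))).coeff_mul
      (ha.memLp_inv hb)).congr (ha.ae_ne_zero.mono fun x hx t => ?_)
    rw [overMat_inv_mulVec_zero hx]
  | 1 => exact (hf 1).congr (ha.ae_ne_zero.mono fun x hx t =>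
      congrFun (overMat_inv_mulVec hx (f t x)) 1)
  | 2 => exact (hf 2).congr (ha.ae_ne_zero.mono fun x hx t =>
      congrFun (overMat_inv_mulVec hx (f t x)) 2)

theorem isLocallyL2_mulVec {Ω : Set Plane} {M : Plane → Matrix (Fin 3) (Fin 3) ℂ}
    (hb : IsBoundedCoefficient Ω M) {h : ℝ → Plane → Fin 3 → ℂ}
    (hh : ∀ i, IsLocallyL2 Ω fun t x => h t x i) (i : Fin 3) :
    IsLocallyL2 Ω fun t x => (M x *ᵥ h t x) i := by
  simp only [Matrix.mulVec, dotProduct, Fin.sum_univ_three]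
  exact (((hh 0).coeff_mul (hb i 0)).add ((hh 1).coeff_mul (hb i 1))).add
    ((hh 2).coeff_mul (hb i 2))

/-! ### Bookkeeping for distributions on the cylinder -/

theorem ae_cylinder {Ω : Set Plane} {u v : ℝ → Plane → ℂ}
    (h : ∀ᵐ x ∂volume.restrict Ω, ∀ t, u t x = v t x) :
    ∀ᵐ p : ℝ × Plane ∂volume.restrict (univ ×ˢ Ω), u p.1 p.2 = v p.1 p.2 := by
  rw [restrict_univ_prod]
  exact (Measure.quasiMeasurePreserving_snd.ae h).mono fun p hp => hp p.1

theorem distDeriv_cylinder_congr {Ω : Set Plane} {u v : ℝ → Plane → ℂ}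
    (h : ∀ᵐ x ∂volume.restrict Ω, ∀ t, u t x = v t x) (e : ℝ × Plane) (φ : ℝ × Plane → ℂ) :
    distDeriv (univ ×ˢ Ω) e (fun p => u p.1 p.2) φ
      = distDeriv (univ ×ˢ Ω) e (fun p => v p.1 p.2) φ := by
  unfold distDeriv
  congr 1
  refine integral_congr_ae ((ae_cylinder h).mono fun p hp => ?_)
  simp only [hp]

theorem distOf_const_mul {X : Type*} [MeasureSpace X] (U : Set X) (c : ℂ) (u φ : X → ℂ) :
    distOf U (fun x => c * u x) φ = c * distOf U u φ := by
  simp only [distOf, ← integral_const_mul]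
  congr 1
  funext x
  ring

theorem distCurl3_zero (W : Set (ℝ × Plane)) (G : ℝ × Plane → Fin 3 → ℂ) (φ : ℝ × Plane → ℂ) :
    distCurl3 W G φ 0 = distDeriv W (dir 1) (fun p => G p 2) φ
      - distDeriv W (dir 2) (fun p => G p 1) φ := rfl

theorem distCurl3_one (W : Set (ℝ × Plane)) (G : ℝ × Plane → Fin 3 → ℂ) (φ : ℝ × Plane → ℂ) :
    distCurl3 W G φ 1 = distDeriv W (0, basisVec 1) (fun p => G p 0) φ
      - distDeriv W (dir 0) (fun p => G p 2) φ := rfl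

theorem distCurl3_two (W : Set (ℝ × Plane)) (G : ℝ × Plane → Fin 3 → ℂ) (φ : ℝ × Plane → ℂ) :
    distCurl3 W G φ 2 = distDeriv W (dir 0) (fun p => G p 1) φ
      - distDeriv W (0, basisVec 0) (fun p => G p 0) φ := rfl

theorem IsWeaklyLipschitzDomain.isFiniteMeasure {Ω : Set Plane} (h : IsWeaklyLipschitzDomain Ω) :
    IsFiniteMeasure (volume.restrict Ω) := by
  rw [isFiniteMeasure_restrict]
  exact h.isBounded.measure_lt_top.ne

end Waveguide

/-! ### Assembly of Maxwell's equations and the boundary conditions -/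

open Waveguide
theorem proposition2p2 (Ω : Set Plane) (hΩ : IsWeaklyLipschitzDomain Ω)
    (μ ε : Plane → Matrix (Fin 3) (Fin 3) ℂ)
    (hμ : IsBoundedCoefficient Ω μ) (hε : IsBoundedCoefficient Ω ε)
    (hμa : IsStrictlyAccretive Ω μ) (hεa : IsStrictlyAccretive Ω ε)
    (ω : ℂ) (hω : ω ≠ 0)
    (f g : ℝ → Plane → Fin 3 → ℂ)
    (hf : AEStronglyMeasurable (fun p : ℝ × Plane => f p.1 p.2)
      (volume.restrict (univ ×ˢ Ω)))
    (hg : AEStronglyMeasurable (fun p : ℝ × Plane => g p.1 p.2)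
      (volume.restrict (univ ×ˢ Ω)))
    (F : ℝ → Plane → C6) (hFfg : F = fun t x => Sum.elim (f t x) (g t x))
    (hF : ∀ t, MemLp (F t) 2 (volume.restrict Ω))
    (hrange : ∀ t, MemRangeD Ω ω (F t))
    (hode : SolvesODE Ω ω μ ε F hF)
    (H E : ℝ → Plane → Fin 3 → ℂ)
    (hH : H = fun t x => (overMat (μ x))⁻¹ *ᵥ f t x)
    (hE : E = fun t x => (overMat (ε x))⁻¹ *ᵥ g t x) :
    SolvesMaxwell Ω ω μ ε H E ∧
    ∀ t : ℝ,
      (MemLp (fun x => (μ x *ᵥ H t x) 0) 2 (volume.restrict Ω) ∧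
        MemHDivZero Ω (fun x => par (μ x *ᵥ H t x))) ∧
      (MemLp (fun x => E t x 0) 2 (volume.restrict Ω) ∧
        MemHCurlZero Ω (fun x => par (E t x))) := by
  have mΩ : MeasurableSet Ω := hΩ.isOpen.measurableSet
  have := hΩ.isFiniteMeasure
  choose V hV hG hd using hode
  choose U hU using hrange
  have hcont : Continuous fun t => (hF t).toLp (F t) :=
    continuous_iff_continuousAt.2 fun t => (hd t).continuousAt
  have FL : ∀ j, IsLocallyL2 Ω fun t x => F t x j := by
    refine fun j => isLocallyL2_of_continuous hF hcont j ?_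
    subst hFfg
    match j with
    | .inl i => exact (continuous_apply i).comp_aestronglyMeasurable hf
    | .inr i => exact (continuous_apply i).comp_aestronglyMeasurable hg
  have HL : ∀ i, IsLocallyL2 Ω fun t x => H t x i := by
    subst hH hFfg
    exact isLocallyL2_overMat_inv hμ hμa fun i => FL (.inl i)
  have EL : ∀ i, IsLocallyL2 Ω fun t x => E t x i := by
    subst hE hFfg
    exact isLocallyL2_overMat_inv hε hεa fun i => FL (.inr i)
  have μHL := isLocallyL2_mulVec hμ HL
  have εEL := isLocallyL2_mulVec hε EL
  -- The exceptional set is where `μ_⊥⊥` or `ε_⊥⊥` vanishes, hence independent of `t`.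
  have aeF : ∀ᵐ x ∂volume.restrict Ω, ∀ t, F t x =
      Sum.elim ![(μ x *ᵥ H t x) 0, H t x 1, H t x 2] ![(ε x *ᵥ E t x) 0, E t x 1, E t x 2] := by
    filter_upwards [hμa.ae_ne_zero, hεa.ae_ne_zero] with x h1 h2 t
    subst hH hE hFfg
    simp only [← overMat_inv_mulVec h1, ← overMat_inv_mulVec h2]
  have aeB : ∀ᵐ x ∂volume.restrict Ω, ∀ t, matB (μ x) (ε x) *ᵥ F t x =
      Sum.elim ![H t x 0, (μ x *ᵥ H t x) 1, (μ x *ᵥ H t x) 2]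
        ![E t x 0, (ε x *ᵥ E t x) 1, (ε x *ᵥ E t x) 2] := by
    filter_upwards [hμa.ae_ne_zero, hεa.ae_ne_zero] with x h1 h2 t
    subst hH hE hFfg
    simp only [matB_mulVec h1 h2, underMat_mulVec]
  have divμH : ∀ t, HasDivZero Ω (fun x => par (μ x *ᵥ H t x)) (fun x => V t x (.inl 0)) :=
    fun t => (hG t).2.1.congr mΩ (aeB.mono fun x hx => by simp only [hx t]; rfl)
  have divεE : ∀ t, HasDiv Ω (fun x => par (ε x *ᵥ E t x)) (fun x => V t x (.inr 0)) :=
    fun t => (hG t).2.2.1.congr (aeB.mono fun x hx => by simp only [hx t]; rfl)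
  have gradH : ∀ t, ∃ p, HasGrad Ω (fun x => H t x 0) p ∧ ∀ᵐ x ∂volume.restrict Ω,
      par (fstHalf (V t x)) = -p x + (Complex.I * ω) • rotJ (par (ε x *ᵥ E t x)) := by
    intro t
    obtain ⟨p, hp, hVp⟩ := (hG t).2.2.2.1
    refine ⟨p, hp.congr (aeB.mono fun x hx => by simp only [hx t]; rfl), ?_⟩
    filter_upwards [hVp, aeB] with x h1 h2
    rw [h1, h2 t]
    rfl
  have gradE : ∀ t, ∃ q, HasGrad Ω (fun x => E t x 0) q ∧ ∀ᵐ x ∂volume.restrict Ω,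
      par (sndHalf (V t x)) = -((Complex.I * ω) • rotJ (par (μ x *ᵥ H t x))) - q x := by
    intro t
    obtain ⟨q, hq, hVq⟩ := (hG t).2.2.2.2
    refine ⟨q, hq.hasGrad.congr (aeB.mono fun x hx => by simp only [hx t]; rfl), ?_⟩
    filter_upwards [hVq, aeB] with x h1 h2
    rw [h1, h2 t]
    rfl
  choose p hp hVp using gradH
  choose q hq hVq using gradE
  -- From here to `curlE` the range condition is used: `U` is a preimage of `F(t)` under `D`.
  have curlH : ∀ t, HasCurl Ω (fun x => par (H t x)) fun x =>
      Complex.I * ω * F t x (.inr 0) := by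
    intro t
    obtain ⟨r, hr, hFr⟩ := (hU t).2.2.1
    refine (hU t).2.1.hasCurl_rotJ_add hr.hasCurl (Complex.I * ω) (-1) ?_
    filter_upwards [hFr, aeF] with x h1 h2
    rw [neg_one_smul, add_comm, ← h1, h2 t]
    rfl
  have parE : ∀ t, ∃ u r, HasGradZero Ω u r ∧ ∀ᵐ x ∂volume.restrict Ω, par (E t x) =
      (-(Complex.I * ω)) • rotJ (par (fstHalf (U t x))) + (-1 : ℂ) • r x := by
    intro t
    obtain ⟨r, hr, hFr⟩ := (hU t).2.2.2
    refine ⟨_, r, hr, ?_⟩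
    filter_upwards [hFr, aeF] with x h1 h2
    rw [neg_one_smul, neg_smul, ← sub_eq_add_neg, ← h1, h2 t]
    rfl
  have curlE : ∀ t, HasCurlZero Ω (fun x => par (E t x)) fun x =>
      -(Complex.I * ω) * F t x (.inl 0) := by
    intro t
    obtain ⟨u, r, hr, hEr⟩ := parE t
    obtain ⟨h1, w', h2⟩ := (hU t).1
    -- The same identity is applied twice, on `Ω` and on the whole plane to the zero extensions of
    -- `U₂` and `∇₀U₃`; off `Ω` both sides vanish.
    refine ⟨h1.hasCurl_rotJ_add hr.hasGrad.hasCurl _ _ hEr, _,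
      h2.hasCurl_rotJ_add (hr.hasCurl_indicator mΩ) (-(Complex.I * ω)) (-1) ?_⟩
    rw [Measure.restrict_univ]
    filter_upwards [(ae_restrict_iff' mΩ).1 hEr] with x hx
    by_cases hxΩ : x ∈ Ω
    · simpa [hxΩ] using hx hxΩ
    · ext i
      fin_cases i <;> simp [hxΩ, rotJ]
  have aeF' : ∀ (j : Fin 3 ⊕ Fin 3) (e : ℝ × Plane) (φ : ℝ × Plane → ℂ),
      distDeriv (univ ×ˢ Ω) e (fun p => F p.1 p.2 j) φ = distDeriv (univ ×ˢ Ω) e (fun p =>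
        (Sum.elim ![(μ p.2 *ᵥ H p.1 p.2) 0, H p.1 p.2 1, H p.1 p.2 2]
          ![(ε p.2 *ᵥ E p.1 p.2) 0, E p.1 p.2 1, E p.1 p.2 2] : C6) j) φ := fun j e φ =>
    distDeriv_cylinder_congr (v := fun t x =>
        (Sum.elim ![(μ x *ᵥ H t x) 0, H t x 1, H t x 2]
          ![(ε x *ᵥ E t x) 0, E t x 1, E t x 2] : C6) j)
      (aeF.mono fun x hx t => congrFun (hx t) j) e φ
  have ofμ : ∀ φ : ℝ × Plane → ℂ, distOf (univ ×ˢ Ω) (fun p => F p.1 p.2 (.inl 0)) φ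
      = distOf (univ ×ˢ Ω) (fun p => (μ p.2 *ᵥ H p.1 p.2) 0) φ := fun φ =>
    integral_congr_ae ((ae_cylinder (u := fun t x => F t x (.inl 0))
      (v := fun t x => (μ x *ᵥ H t x) 0) (aeF.mono fun x hx t => congrFun (hx t) _)).mono
      fun p hp => congrArg (φ p * ·) hp)
  have ofε : ∀ φ : ℝ × Plane → ℂ, distOf (univ ×ˢ Ω) (fun p => F p.1 p.2 (.inr 0)) φ
      = distOf (univ ×ˢ Ω) (fun p => (ε p.2 *ᵥ E p.1 p.2) 0) φ := fun φ =>
    integral_congr_ae ((ae_cylinder (u := fun t x => F t x (.inr 0))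
      (v := fun t x => (ε x *ᵥ E t x) 0) (aeF.mono fun x hx t => congrFun (hx t) _)).mono
      fun p hp => congrArg (φ p * ·) hp)
  have bounded_const : ∀ c : ℂ, MemLp (fun _ : Plane => c) ∞ (volume.restrict Ω) :=
    fun c => memLp_const c
  have parL : ∀ {h : ℝ → Plane → Fin 3 → ℂ}, (∀ i, IsLocallyL2 Ω fun t x => h t x i) →
      ∀ k, IsLocallyL2 Ω fun t x => par (h t x) k := fun hh k =>
    match k with
    | 0 => hh 1
    | 1 => hh 2
  refine ⟨⟨fun a b => .of_eval fun i => (HL i).loc a b, fun a b => .of_eval fun i => (EL i).loc a b,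
    fun φ hφ => ?_, fun φ hφ i => ?_, fun φ hφ i => ?_, fun φ hφ => ?_⟩, fun t =>
    ⟨⟨(μHL 0).slice t, _, divμH t⟩, (EL 0).slice t, _, curlE t⟩⟩
  · have := div_cylinder mΩ hF hV hd (FL _) (parL μHL) (fun t => (divμH t).1) hφ
    rw [aeF'] at this
    rw [distDiv3, Fin.sum_univ_three]
    exact this
  · match i with
    | 0 =>
      have := curl_cylinder mΩ (parL EL) ((FL (.inl 0)).coeff_mul (bounded_const _))
        (fun t => (curlE t).1) hφ
      rw [distOf_const_mul _ _ (fun p : ℝ × Plane => F p.1 p.2 (.inl 0)), ofμ] at this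
      simp only [par, Matrix.cons_val] at this
      rw [distCurl3_zero]
      linear_combination this
    | 1 =>
      -- Since `J(a, b) = (-b, a)`, each transversal row involves the other transversal component,
      -- and the sign of `iω` alternates between the two rows.
      have := grad_cylinder mΩ hF hV hd (FL (.inr 2)) (EL 0) (μHL 1) (-(Complex.I * ω)) 1 hq
        (fun t => (hVq t).mono fun x hx => (congrFun hx 1).trans (by simp [rotJ, par]; ring)) hφ
      rw [aeF'] at this
      simp only [Sum.elim_inr, Matrix.cons_val] at this
      rw [distCurl3_one]
      linear_combination -this
    | 2 =>
      have := grad_cylinder mΩ hF hV hd (FL (.inr 1)) (EL 0) (μHL 2) (Complex.I * ω) 0 hq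
        (fun t => (hVq t).mono fun x hx => (congrFun hx 0).trans (by simp [rotJ, par]; ring)) hφ
      rw [aeF'] at this
      simp only [Sum.elim_inr, Matrix.cons_val] at this
      rw [distCurl3_two]
      linear_combination this
  · match i with
    | 0 =>
      have := curl_cylinder mΩ (parL HL) ((FL (.inr 0)).coeff_mul (bounded_const _)) curlH hφ
      rw [distOf_const_mul _ _ (fun p : ℝ × Plane => F p.1 p.2 (.inr 0)), ofε] at this
      simp only [par, Matrix.cons_val] at this
      rw [distCurl3_zero]
      linear_combination -this
    | 1 =>
      have := grad_cylinder mΩ hF hV hd (FL (.inl 2)) (HL 0) (εEL 1) (Complex.I * ω) 1 hp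
        (fun t => (hVp t).mono fun x hx => (congrFun hx 1).trans (by simp [rotJ, par])) hφ
      rw [aeF'] at this
      simp only [Sum.elim_inl, Matrix.cons_val] at this
      rw [distCurl3_one]
      linear_combination this
    | 2 =>
      have := grad_cylinder mΩ hF hV hd (FL (.inl 1)) (HL 0) (εEL 2) (-(Complex.I * ω)) 0 hp
        (fun t => (hVp t).mono fun x hx => (congrFun hx 0).trans (by simp [rotJ, par])) hφ
      rw [aeF'] at this
      simp only [Sum.elim_inl, Matrix.cons_val] at this
      rw [distCurl3_two]
      linear_combination -this
  · have := div_cylinder mΩ hF hV hd (FL _) (parL εEL) divεE hφ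
    rw [aeF'] at this
    rw [distDiv3, Fin.sum_univ_three]
    exact this
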